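/- Let $0<q<1$, $(z;q)_\infty=\prod_{r\ge 0}(1-zq^r)$, $G(z)=1/(z;q)_\infty$ and $E_q(z)=(z;q)_\infty$. All complex powers are principal. The $q$-Natural transform of the first type is $$N_q(f)(u;v)=\frac{1}{(1-q)u}\int_0^{u/v}f(t)\,E_q\!\Big(q\frac vu t\Big)\,d_qt,\qquad \int_0^a g(t)\,d_qt=(1-q)a\sum_{r\ge0}g(aq^r)q^r,$$ and it exists if the last series converges absolutely. For integers $0\le m\le N$, $0\le n\le M$, $a_j,b_j\in\mathbb C$ and real $\alpha_j,\beta_j>0$ (in particular for positive integers) put $$H^{m,n}_{M,N}\!\left[x;q\,\middle|\,{(a_1,\alpha_1),\dots,(a_M,\alpha_M)\atop (b_1,\beta_1),\dots,(b_N,\beta_N)}\right]=\frac1{2\pi i}\int_C\frac{\prod_{j=1}^mG(q^{b_j-\beta_js})\prod_{j=1}^nG(q^{1-a_j+\alpha_js})\,\pi x^s}{\prod_{j=m+1}^NG(q^{1-b_j+\beta_js})\prod_{j=n+1}^MG(q^{a_j-\alpha_js})\,G(q^{1-s})\sin\pi s}\,ds.$$ Here a contour $C$ for these parameters is an upward vertical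 line with indentations of bounded size (precisely: a simple curve with a Lipschitz parametrization $\gamma:\mathbb R\to\mathbb C$ such that $\gamma(t)-it$ is bounded) that has all poles of $G(q^{b_j-\beta_js})$, $1\le j\le m$, on its right and all poles of $G(q^{1-a_j+\alpha_js})$, $1\le j\le n$, on its left, and that keeps a positive distance from all these poles and from the zeros of $\sin\pi s$. Let $\lambda\in\mathbb C\setminus\{0\}$, $k\in\mathbb R\setminus\{0\}$, and let $u,v\in\mathbb C\setminus\{0\}$ satisfy $-\pi<\arg u-\arg v\le\pi$ (for example $u>0$ and $\operatorname{Re}v>0$) and $|\arg(\lambda u^k/v^k)|<\pi$ (for $u,v>0$ this says that $\lambda$ is not a negative real number). Let $C$ be a contour for the function $H^{m,n}_{M,N}[\,\cdot\,;q\,|\,(a_j,\alpha_j);(b_j,\beta_j)]$ such that $\operatorname{Re}(\lambda+ks)\ge c$ on $C$ for some $c>-1$. (i) If $k>0$, then $C$ is also a contour for the function $H^{m,n+1}_{M+1,N}$ below, the contour integrals of all values of $H$ that occur converge absolutely, the transform on the left exists, and, with the same contour $C$ on both sides, $$N_q\!\left(x^\lambda H^{m,n}_{M,N}\!\left[\lambda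 x^k;q\,\middle|\,{(a_1,\alpha_1),\dots,(a_M,\alpha_M)\atop(b_1,\beta_1),\dots,(b_N,\beta_N)}\right]\right)(u;v)=\frac{u^\lambda}{v^{\lambda+1}G(q)}\,H^{m,n+1}_{M+1,N}\!\left[\lambda\frac{u^k}{v^k};q\,\middle|\,{(-\lambda,k),(a_1,\alpha_1),\dots,(a_M,\alpha_M)\atop(b_1,\beta_1),\dots,(b_N,\beta_N)}\right].$$ (ii) If $k<0$, then $C$ is also a contour for the function $H^{m+1,n}_{M,N+1}$ below, the contour integrals of all values of $H$ that occur converge absolutely, the transform on the left exists, and, with the same contour $C$ on both sides, $$N_q\!\left(x^\lambda H^{m,n}_{M,N}\!\left[\lambda x^k;q\,\middle|\,{(a_1,\alpha_1),\dots,(a_M,\alpha_M)\atop(b_1,\beta_1),\dots,(b_N,\beta_N)}\right]\right)(u;v)=\frac{u^\lambda}{v^{\lambda+1}G(q)}\,H^{m+1,n}_{M,N+1}\!\left[\lambda\frac{u^k}{v^k};q\,\middle|\,{(a_1,\alpha_1),\dots,(a_M,\alpha_M)\atop(1+\lambda,-k),(b_1,\beta_1),\dots,(b_N,\beta_N)}\right].$$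 -/

import Mathlib

open scoped Real

noncomputable section

/-! ### Basic `q`-calculus, `0 < q < 1` -/

/-- The infinite `q`-shifted factorial `(z; q)_∞ = ∏_{r ≥ 0} (1 - z q^r)`. -/
def qPochInf (q : ℝ) (z : ℂ) : ℂ := ∏' r : ℕ, (1 - z * (q : ℂ) ^ r)

/-- `G(z) = 1 / (z; q)_∞`. -/
def qG (q : ℝ) (z : ℂ) : ℂ := 1 / qPochInf q z

/-- The `q`-exponential function `E_q(z) = (z; q)_∞`. -/
def qExpE (q : ℝ) (z : ℂ) : ℂ := qPochInf q z

/-- Absolute convergence of the series defining the Jackson integral from `0` to `a`. -/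
def JacksonIntegrable (q : ℝ) (a : ℂ) (f : ℂ → ℂ) : Prop :=
  Summable fun r : ℕ => ‖f (a * (q : ℂ) ^ r) * (q : ℂ) ^ r‖

/-- The Jackson integral `∫_0^a f(x) d_q x = (1 - q) a ∑_{r ≥ 0} f(a q^r) q^r`. -/
def jacksonIntegral (q : ℝ) (a : ℂ) (f : ℂ → ℂ) : ℂ :=
  (1 - (q : ℂ)) * a * ∑' r : ℕ, f (a * (q : ℂ) ^ r) * (q : ℂ) ^ r

/-- The function under the Jackson integral that defines the `q`-Natural transform of `f`. -/
def qNaturalIntegrand (q : ℝ) (f : ℂ → ℂ) (u v : ℂ) (t : ℂ) : ℂ :=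
  f t * qExpE q ((q : ℂ) * (v / u) * t)

/-- The `q`-Natural transform (first type) of `f` exists at `(u; v)`. -/
def QNaturalExists (q : ℝ) (f : ℂ → ℂ) (u v : ℂ) : Prop :=
  JacksonIntegrable q (u / v) (qNaturalIntegrand q f u v)

/-- The `q`-Natural transform of the first type,
`N_q(f)(u; v) = 1 / ((1 - q) u) ∫_0^{u/v} f(t) E_q(q (v/u) t) d_q t`. -/
def qNatural (q : ℝ) (f : ℂ → ℂ) (u v : ℂ) : ℂ :=
  1 / ((1 - (q : ℂ)) * u) * jacksonIntegral q (u / v) (qNaturalIntegrand q f u v)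

/-! ### The `q`-analogue of Fox's `H`-function

The parameters are `a j = (a_j, α_j)` for `j < M` and `b j = (b_j, β_j)` for `j < N`. -/

/-- The Mellin–Barnes integrand of the `q`-Fox `H`-function (without the factor `1 / (2 π i)`). -/
def foxHIntegrand (q : ℝ) {M N : ℕ} (m n : ℕ) (a : Fin M → ℂ × ℝ) (b : Fin N → ℂ × ℝ)
    (x s : ℂ) : ℂ :=
  ((∏ j : Fin N with j.val < m, qG q ((q : ℂ) ^ ((b j).1 - (b j).2 * s))) *
      (∏ j : Fin M with j.val < n, qG q ((q : ℂ) ^ (1 - (a j).1 + (a j).2 * s))) *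
      (π : ℂ) * x ^ s) /
    ((∏ j : Fin N with m ≤ j.val, qG q ((q : ℂ) ^ (1 - (b j).1 + (b j).2 * s))) *
      (∏ j : Fin M with n ≤ j.val, qG q ((q : ℂ) ^ ((a j).1 - (a j).2 * s))) *
      qG q ((q : ℂ) ^ (1 - s)) * Complex.sin (π * s))

/-- The poles of `s ↦ G(q^{b_j - β_j s})`, `j < m`. -/
def foxLowerPoles (q : ℝ) {N : ℕ} (m : ℕ) (b : Fin N → ℂ × ℝ) : Set ℂ :=
  {s | ∃ j : Fin N, j.val < m ∧ ∃ r : ℕ,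
    1 - (q : ℂ) ^ ((b j).1 - (b j).2 * s) * (q : ℂ) ^ r = 0}

/-- The poles of `s ↦ G(q^{1 - a_j + α_j s})`, `j < n`. -/
def foxUpperPoles (q : ℝ) {M : ℕ} (n : ℕ) (a : Fin M → ℂ × ℝ) : Set ℂ :=
  {s | ∃ j : Fin M, j.val < n ∧ ∃ r : ℕ,
    1 - (q : ℂ) ^ (1 - (a j).1 + (a j).2 * s) * (q : ℂ) ^ r = 0}

/-- A simple curve which is a vertical line with indentations of bounded size, traversed upwards
with bounded speed. -/
structure IsIndentedVerticalLine (γ : ℝ → ℂ) : Prop where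
  lipschitz : ∃ K : NNReal, LipschitzWith K γ
  injective : Function.Injective γ
  near_line : ∃ c B : ℝ, ∀ t : ℝ, ‖γ t - ((c : ℂ) + (t : ℂ) * Complex.I)‖ ≤ B

/-- `p` lies to the right of the curve `γ`: off the curve, it can be joined to all points
that are sufficiently far to the right. -/
def IsRightOf (γ : ℝ → ℂ) (p : ℂ) : Prop :=
  ∃ R : ℝ, ∀ z : ℂ, R < z.re → JoinedIn (Set.range γ)ᶜ p z

/-- `p` lies to the left of the curve `γ`: off the curve, it can be joined to all points
that are sufficiently far to the left. -/
def IsLeftOf (γ : ℝ → ℂ) (p : ℂ) : Prop :=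
  ∃ R : ℝ, ∀ z : ℂ, z.re < R → JoinedIn (Set.range γ)ᶜ p z

/-- `γ` parametrizes a contour of the `q`-Fox `H`-function with the given parameters: a vertical
line with indentations, having the poles of `G(q^{b_j - β_j s})`, `j < m`, on its right and those
of `G(q^{1 - a_j + α_j s})`, `j < n`, on its left, and keeping a positive distance from
all these poles and from the zeros of `sin (π s)`. -/
structure IsFoxHContour (q : ℝ) (γ : ℝ → ℂ) {M N : ℕ} (m n : ℕ)
    (a : Fin M → ℂ × ℝ) (b : Fin N → ℂ × ℝ) : Prop where
  line : IsIndentedVerticalLine γ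
  right : ∀ p ∈ foxLowerPoles q m b, IsRightOf γ p
  left : ∀ p ∈ foxUpperPoles q n a, IsLeftOf γ p
  away : ∃ δ : ℝ, 0 < δ ∧
    ∀ p ∈ foxLowerPoles q m b ∪ foxUpperPoles q n a ∪ Set.range (fun l : ℤ => (l : ℂ)),
      ∀ t : ℝ, δ ≤ ‖γ t - p‖

/-- Absolute convergence of the contour integral defining the `q`-Fox `H`-function at `x`. -/
def FoxHConverges (q : ℝ) (γ : ℝ → ℂ) {M N : ℕ} (m n : ℕ)
    (a : Fin M → ℂ × ℝ) (b : Fin N → ℂ × ℝ) (x : ℂ) : Prop :=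
  MeasureTheory.Integrable fun t : ℝ => foxHIntegrand q m n a b x (γ t) * deriv γ t

/-- The `q`-Fox `H`-function `H^{m,n}_{M,N}[x; q | a; b]`, with the contour parametrized by `γ`. -/
def qFoxH (q : ℝ) (γ : ℝ → ℂ) {M N : ℕ} (m n : ℕ)
    (a : Fin M → ℂ × ℝ) (b : Fin N → ℂ × ℝ) (x : ℂ) : ℂ :=
  1 / (2 * (π : ℂ) * Complex.I) * ∫ t : ℝ, foxHIntegrand q m n a b x (γ t) * deriv γ t

end

open Filter Topology MeasureTheory

/-! ### The infinite `q`-shifted factorial -/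

section QPochhammer

variable {q : ℝ}

/-! At the nodes `t = (u/v) q^r` of the Jackson sum the kernel `E_q(q (v/u) t)` equals `(q^(r+1);
q)_∞`, and the Mellin–Barnes integrand of `H[λ t^k]` is the one at `X = λ u^k / v^k` times `q^(k s
r)`. Together with `t^λ` and the weight `q^r`, the `r`-th term is therefore a constant times the
contour integral of `(q^(r+1); q)_∞ W^r` against the integrand at `X`, where `W = q^(1 + λ + k s)`.
Euler's expansion (`hasSum_qPochInf_mul_pow`) sums these to `(q; q)_∞ G(W)`. The factor `G(W)` is
exactly what the new parameter `(-λ, k)`, or `(1 + λ, -k)` if `k < 0`, adds to the integrand, and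
`(q; q)_∞ = 1 / G(q)` gives the prefactor.

The bound `Re (λ + k s) ≥ c > -1` is used twice. It gives `|W| ≤ q^(1 + c) < 1` uniformly on the
contour, which justifies exchanging sum and integral (`hasSum_integral_qPochInf_mul_pow`). It also
keeps the new poles, where `Re (1 + λ + k p) ≤ 0`, on the correct side at a positive distance
(`IsFoxHContour.cons_upper`, `IsFoxHContour.cons_lower`).

Absolute convergence (`IsFoxHContour.foxHConverges`) holds because `Re s` is bounded on the contour,
so all `q`-factors stay bounded away from their poles, while `x^s / sin (π s)` decays like `exp (-(π
- |arg x|) |t|)`. -/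

lemma summable_norm_mul_pow (hq0 : 0 < q) (hq1 : q < 1) (z : ℂ) :
    Summable fun r : ℕ => ‖-(z * (q : ℂ) ^ r)‖ := by
  simpa [abs_of_pos hq0] using (summable_geometric_of_lt_one hq0.le hq1).mul_left ‖z‖

lemma multipliable_one_sub_mul_pow (hq0 : 0 < q) (hq1 : q < 1) (z : ℂ) :
    Multipliable fun r : ℕ => 1 - z * (q : ℂ) ^ r := by
  simpa [sub_eq_add_neg] using multipliable_one_add_of_summable (summable_norm_mul_pow hq0 hq1 z)

lemma qPochInf_eq_mul (hq0 : 0 < q) (hq1 : q < 1) (z : ℂ) :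
    qPochInf q z = (1 - z) * qPochInf q (z * q) := by
  have h := tprod_eq_zero_mul' (f := fun r : ℕ => 1 - z * (q : ℂ) ^ r)
    ((multipliable_one_sub_mul_pow hq0 hq1 (z * q)).congr fun r => by ring)
  simp only [qPochInf]
  rw [h]
  simp only [pow_zero, mul_one]
  congr 2
  ext r
  ring

lemma qPochInf_ne_zero (hq0 : 0 < q) (hq1 : q < 1) {z : ℂ}
    (hz : ∀ r : ℕ, 1 - z * (q : ℂ) ^ r ≠ 0) : qPochInf q z ≠ 0 := by
  simpa [qPochInf, sub_eq_add_neg] using tprod_one_add_ne_zero_of_summable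
    (fun r => by simpa [sub_eq_add_neg] using hz r) (summable_norm_mul_pow hq0 hq1 z)

lemma continuous_qPochInf (hq0 : 0 < q) (hq1 : q < 1) : Continuous (qPochInf q) := by
  rw [continuous_iff_continuousAt]
  intro z
  -- Weierstrass majorant on the ball of radius `‖z‖ + 1`: it makes the product converge locally
  -- uniformly there.
  have hu : Summable fun r : ℕ => (‖z‖ + 1) * q ^ r :=
    (summable_geometric_of_lt_one hq0.le hq1).mul_left _
  have h := hu.hasProdLocallyUniformlyOn_nat_one_add (R := ℂ)
    (f := fun (r : ℕ) (w : ℂ) => -(w * (q : ℂ) ^ r)) (K := Metric.ball 0 (‖z‖ + 1))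
    Metric.isOpen_ball (Eventually.of_forall fun r w hw => by
      rw [mem_ball_zero_iff] at hw
      simp only [norm_neg, norm_mul, norm_pow, Complex.norm_real, Real.norm_eq_abs,
        abs_of_pos hq0]
      gcongr) (fun r => by fun_prop)
  have hc : ContinuousOn (fun w : ℂ => ∏' r : ℕ, (1 + -(w * (q : ℂ) ^ r)))
      (Metric.ball 0 (‖z‖ + 1)) :=
    h.tendstoLocallyUniformlyOn_finsetRange.continuousOn
      (Eventually.of_forall fun n => by fun_prop).frequently
  have hz : z ∈ Metric.ball (0 : ℂ) (‖z‖ + 1) := by simp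
  simpa [qPochInf, sub_eq_add_neg, Function.comp_def, funext_iff] using!
    hc.continuousAt (Metric.isOpen_ball.mem_nhds hz)

lemma exists_norm_qPochInf_le (hq0 : 0 < q) (hq1 : q < 1) (R : ℝ) :
    ∃ C : ℝ, 0 ≤ C ∧ ∀ z : ℂ, ‖z‖ ≤ R → ‖qPochInf q z‖ ≤ C := by
  obtain ⟨C, hC⟩ := (isCompact_closedBall (0 : ℂ) R).exists_bound_of_continuousOn
    (continuous_qPochInf hq0 hq1).continuousOn
  exact ⟨max C 0, le_max_right _ _, fun z hz => (hC z (by simpa using hz)).trans (le_max_left _ _)⟩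

lemma norm_ofReal_pow_succ_le_one (hq0 : 0 < q) (hq1 : q < 1) (r : ℕ) :
    ‖(q : ℂ) ^ (r + 1)‖ ≤ 1 := by
  simpa [abs_of_pos hq0] using pow_le_one₀ hq0.le hq1.le

/-- Euler's expansion `∑ z^r / (q; q)_r = 1 / (z; q)_∞`, multiplied by `(q; q)_∞`. -/
lemma hasSum_qPochInf_mul_pow (hq0 : 0 < q) (hq1 : q < 1) {z : ℂ} (hz : ‖z‖ < 1) :
    HasSum (fun r : ℕ => qPochInf q ((q : ℂ) ^ (r + 1)) * z ^ r)
      (qPochInf q q * qG q z) := by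
  obtain ⟨C, hC0, hC⟩ := exists_norm_qPochInf_le hq0 hq1 1
  set c : ℕ → ℂ := fun r => qPochInf q ((q : ℂ) ^ (r + 1)) with hc
  have hcC : ∀ r, ‖c r‖ ≤ C := fun r => hC _ (norm_ofReal_pow_succ_le_one hq0 hq1 r)
  have hqn : ‖(q : ℂ)‖ = q := by simp [abs_of_pos hq0]
  have hsum : ∀ w : ℂ, ‖w‖ < 1 → Summable fun r => c r * w ^ r := fun w hw =>
    .of_norm_bounded ((summable_geometric_of_lt_one (norm_nonneg w) hw).mul_left C) fun r => by
      rw [norm_mul, norm_pow]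
      exact mul_le_mul_of_nonneg_right (hcC r) (by positivity)
  set F : ℂ → ℂ := fun w => ∑' r, c r * w ^ r with hF
  have hmulq : ∀ w : ℂ, ‖w‖ < 1 → ‖w * q‖ < 1 := fun w hw => by
    rw [norm_mul, hqn]
    nlinarith [norm_nonneg w]
  -- The coefficients satisfy `c r = (1 - q^(r+1)) c (r+1)`, so `F w - F (w q) = w F w`.
  have hrec : ∀ w : ℂ, ‖w‖ < 1 → F w * (1 - w) = F (w * q) := by
    intro w hw
    have h1 : F w - F (w * q) = ∑' r, (c r * w ^ r - c r * (w * q) ^ r) :=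
      ((hsum w hw).tsum_sub (hsum _ (hmulq w hw))).symm
    rw [((hsum w hw).sub (hsum _ (hmulq w hw))).tsum_eq_zero_add] at h1
    have h2 : ∀ r, c (r + 1) * w ^ (r + 1) - c (r + 1) * (w * q) ^ (r + 1) =
        w * (c r * w ^ r) := by
      intro r
      have : c r = (1 - (q : ℂ) ^ (r + 1)) * c (r + 1) := by
        simp only [hc]
        rw [qPochInf_eq_mul hq0 hq1, ← pow_succ]
      rw [this]
      ring
    simp only [h2, tsum_mul_left] at h1
    simp only [pow_zero, sub_self, zero_add] at h1
    linear_combination h1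
  -- As `n → ∞` this becomes `F z (z; q)_∞ = F 0 = (q; q)_∞`, by continuity of `F` at `0`.
  have hiter : ∀ n : ℕ, F z * ∏ i ∈ Finset.range n, (1 - z * (q : ℂ) ^ i) = F (z * q ^ n) := by
    intro n
    induction n with
    | zero => simp
    | succ n ih =>
      have hlt : ‖z * (q : ℂ) ^ n‖ < 1 := by
        rw [norm_mul, norm_pow, hqn]
        exact (mul_le_of_le_one_right (norm_nonneg z) (pow_le_one₀ hq0.le hq1.le)).trans_lt hz
      rw [Finset.prod_range_succ, ← mul_assoc, ih, hrec _ hlt, pow_succ, mul_assoc]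
  have hcont : ContinuousOn F (Metric.closedBall 0 ‖z‖) := by
    refine continuousOn_tsum (fun r => by fun_prop)
      ((summable_geometric_of_lt_one (norm_nonneg z) hz).mul_left C) fun r w hw => ?_
    rw [norm_mul, norm_pow]
    exact mul_le_mul (hcC r) (pow_le_pow_left₀ (norm_nonneg w) (by simpa using hw) r)
      (by positivity) hC0
  have hlim0 : Tendsto (fun n : ℕ => z * (q : ℂ) ^ n) atTop (𝓝 0) := by
    simpa using (tendsto_pow_atTop_nhds_zero_of_norm_lt_one (x := (q : ℂ))
      (by rw [hqn]; exact hq1)).const_mul z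
  have hlim1 : Tendsto (fun n : ℕ => F (z * (q : ℂ) ^ n)) atTop (𝓝 (F 0)) :=
    (hcont 0 (by simp)).tendsto.comp (tendsto_nhdsWithin_iff.2 ⟨hlim0, .of_forall fun n => by
      simp only [mem_closedBall_zero_iff, norm_mul, norm_pow, hqn]
      exact mul_le_of_le_one_right (norm_nonneg z) (pow_le_one₀ hq0.le hq1.le)⟩)
  have hlim2 : Tendsto (fun n : ℕ => F z * ∏ i ∈ Finset.range n, (1 - z * (q : ℂ) ^ i)) atTop
      (𝓝 (F z * qPochInf q z)) :=
    (multipliable_one_sub_mul_pow hq0 hq1 z).hasProd.tendsto_prod_nat.const_mul _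
  have hF0 : F 0 = qPochInf q q := by
    simp only [hF]
    rw [tsum_eq_single 0 (fun r hr => by simp [hr])]
    simp [hc]
  have heq : F z * qPochInf q z = qPochInf q q := by
    rw [← hF0]
    exact tendsto_nhds_unique (hlim2.congr hiter) hlim1
  have hne : qPochInf q z ≠ 0 := by
    refine qPochInf_ne_zero hq0 hq1 fun r h => ?_
    have h1 : ‖z * (q : ℂ) ^ r‖ = 1 := by rw [← sub_eq_zero.1 h, norm_one]
    rw [norm_mul, norm_pow, hqn] at h1
    exact absurd ((mul_le_of_le_one_right (norm_nonneg z)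
      (pow_le_one₀ hq0.le hq1.le)).trans_lt hz) (by rw [h1]; exact lt_irrefl 1)
  have : qPochInf q q * qG q z = F z := by
    rw [qG, ← heq]
    field_simp
  rw [this]
  exact (hsum z hz).hasSum

end QPochhammer

/-! ### Lower bounds away from the zeros -/

/-- If `exp y` is close to `1`, its principal logarithm is small by continuity at `1`, and that
logarithm differs from `y` by a multiple of `2πi`. -/
lemma exists_le_norm_one_sub_exp {ε : ℝ} (hε : 0 < ε) :
    ∃ η : ℝ, 0 < η ∧ ∀ y : ℂ, (∀ l : ℤ, ε ≤ ‖y - l * (2 * π * Complex.I)‖) →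
      η ≤ ‖1 - Complex.exp y‖ := by
  have hc : ContinuousAt Complex.log 1 := continuousAt_clog (by simp)
  obtain ⟨η, hη, h⟩ := Metric.continuousAt_iff.1 hc ε hε
  refine ⟨η, hη, fun y hy => ?_⟩
  by_contra! hlt
  have h1 : ‖Complex.log (Complex.exp y)‖ < ε := by
    simpa [dist_eq_norm] using h (x := Complex.exp y) (by rwa [dist_comm, dist_eq_norm])
  obtain ⟨l, hl⟩ := Complex.exp_eq_exp_iff_exists_int.1
    (Complex.exp_log (Complex.exp_ne_zero y))
  have := hy (-l)
  rw [hl] at h1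
  push_cast at this
  rw [neg_mul, sub_neg_eq_add] at this
  exact absurd h1 (not_lt.2 this)

/-- Follows from `|sin (π w)| = exp (π Im w) |1 - exp (2πi w)| / 2` in the upper half-plane; the
lower one reduces to it because `sin` is odd. -/
lemma exists_le_norm_sin {δ : ℝ} (hδ : 0 < δ) :
    ∃ η : ℝ, 0 < η ∧ ∀ s : ℂ, (∀ l : ℤ, δ ≤ ‖s - l‖) →
      η * Real.exp (π * |s.im|) ≤ ‖Complex.sin (π * s)‖ := by
  obtain ⟨η, hη, h⟩ := exists_le_norm_one_sub_exp (mul_pos Real.two_pi_pos hδ)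
  refine ⟨η / 2, by positivity, fun s hs => ?_⟩
  have key : ∀ w : ℂ, (∀ l : ℤ, δ ≤ ‖w - l‖) → 0 ≤ w.im →
      η / 2 * Real.exp (π * w.im) ≤ ‖Complex.sin (π * w)‖ := by
    intro w hw _
    have h1 : Complex.sin (π * w) = Complex.exp (-(π * w) * Complex.I) *
        (1 - Complex.exp (2 * π * Complex.I * w)) * (Complex.I / 2) := by
      rw [Complex.sin, mul_sub, ← Complex.exp_add]
      ring_nf
    have h2 : ‖Complex.exp (-(π * w) * Complex.I)‖ = Real.exp (π * w.im) := by
      rw [Complex.norm_exp]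
      simp
    have h3 := h (2 * π * Complex.I * w) fun l => by
      rw [show 2 * π * Complex.I * w - l * (2 * π * Complex.I) =
        (2 * π : ℝ) * Complex.I * (w - l) by push_cast; ring, norm_mul, norm_mul,
        Complex.norm_real, Complex.norm_I, mul_one, Real.norm_of_nonneg Real.two_pi_pos.le]
      exact mul_le_mul_of_nonneg_left (hw l) Real.two_pi_pos.le
    rw [h1, norm_mul, norm_mul, h2]
    have : ‖Complex.I / 2‖ = 1 / 2 := by simp
    rw [this]
    nlinarith [Real.exp_pos (π * w.im)]
  rcases le_total 0 s.im with hi | hi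
  · rw [abs_of_nonneg hi]
    exact key s hs hi
  · rw [abs_of_nonpos hi]
    have := key (-s) (fun l => by
      have := hs (-l)
      rw [← norm_neg]
      push_cast at this
      rwa [show -(-s - (l : ℂ)) = s - -(l : ℂ) by ring]) (by simpa using hi)
    simpa using this

lemma ofReal_cpow_eq_exp {q : ℝ} (hq0 : 0 < q) (w : ℂ) :
    (q : ℂ) ^ w = Complex.exp (Real.log q * w) := by
  rw [Complex.cpow_def_of_ne_zero (by exact_mod_cast hq0.ne'), Complex.ofReal_log hq0.le]

lemma ofReal_cpow_mul_pow {q : ℝ} (hq0 : 0 < q) (w : ℂ) (r : ℕ) :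
    (q : ℂ) ^ w * (q : ℂ) ^ r = (q : ℂ) ^ (w + r) := by
  rw [Complex.cpow_add _ _ (by exact_mod_cast hq0.ne'), Complex.cpow_natCast]

lemma norm_ofReal_cpow_le {q : ℝ} (hq0 : 0 < q) (hq1 : q < 1) {w : ℂ} {R : ℝ} (h : |w.re| ≤ R) :
    ‖(q : ℂ) ^ w‖ ≤ q ^ (-R) := by
  rw [Complex.norm_cpow_eq_rpow_re_of_pos hq0]
  exact Real.rpow_le_rpow_of_exponent_ge hq0 hq1.le (abs_le.1 h).1

/-- `w ↦ G(q^w)` is bounded on vertical strips, away from its poles. -/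
lemma exists_norm_qG_cpow_le {q : ℝ} (hq0 : 0 < q) (hq1 : q < 1) {δ : ℝ} (hδ : 0 < δ) (R : ℝ) :
    ∃ C : ℝ, ∀ w : ℂ, |w.re| ≤ R →
      (∀ p : ℂ, (∃ r : ℕ, 1 - (q : ℂ) ^ p * (q : ℂ) ^ r = 0) → δ ≤ ‖w - p‖) →
      ‖qG q ((q : ℂ) ^ w)‖ ≤ C := by
  have hlog : Real.log q ≠ 0 := (Real.log_neg hq0 hq1).ne
  have hlogC : (Real.log q : ℂ) ≠ 0 := by exact_mod_cast hlog
  obtain ⟨η, hη, h⟩ := exists_le_norm_one_sub_exp (mul_pos (abs_pos.2 hlog) hδ)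
  -- A compact set free of zeros of `(z; q)_∞` that contains every admissible `q^w`. One `η` serves
  -- all `r`, since `q^w q^r = exp (log q (w + r))`.
  set K : Set ℂ := Metric.closedBall 0 (q ^ (-R)) ∩ ⋂ r : ℕ, {z | η ≤ ‖1 - z * (q : ℂ) ^ r‖}
    with hK
  have hKc : IsCompact K := (isCompact_closedBall _ _).inter_right
    (isClosed_iInter fun r => isClosed_le continuous_const (by fun_prop))
  have hcont : ContinuousOn (qG q) K := by
    refine ContinuousOn.div continuousOn_const (continuous_qPochInf hq0 hq1).continuousOn
      fun z hz => qPochInf_ne_zero hq0 hq1 fun r h0 => ?_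
    have := Set.mem_iInter.1 hz.2 r
    rw [Set.mem_ofPred_eq, h0, norm_zero] at this
    linarith
  obtain ⟨C, hC⟩ := hKc.exists_bound_of_continuousOn hcont
  refine ⟨C, fun w hw hp => hC _ ⟨?_, Set.mem_iInter.2 fun r => ?_⟩⟩
  · simpa using norm_ofReal_cpow_le hq0 hq1 hw
  · rw [Set.mem_ofPred_eq, ofReal_cpow_mul_pow hq0, ofReal_cpow_eq_exp hq0]
    refine h _ fun l => ?_
    -- The subtracted point `2πi l / log q - r` is a pole of `w ↦ G(q^w)`.
    have h1 : Real.log q * (w + r) - l * (2 * π * Complex.I) =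
        Real.log q * (w - (l * (2 * π * Complex.I) / Real.log q - r)) := by
      field_simp
      ring
    rw [h1, norm_mul, Complex.norm_real, Real.norm_eq_abs]
    refine mul_le_mul_of_nonneg_left (hp _ ⟨r, ?_⟩) (abs_nonneg _)
    rw [ofReal_cpow_mul_pow hq0, ofReal_cpow_eq_exp hq0, sub_add_cancel, mul_div_cancel₀ _ hlogC,
      Complex.exp_int_mul_two_pi_mul_I, sub_self]

/-! ### Boundedness, integrability and measurability -/

lemma exists_norm_prod_le {ι α : Type*} (s : Finset ι) {f : ι → α → ℂ}
    (h : ∀ j ∈ s, ∃ C : ℝ, ∀ t, ‖f j t‖ ≤ C) : ∃ C : ℝ, ∀ t, ‖∏ j ∈ s, f j t‖ ≤ C := by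
  classical
  induction s using Finset.induction_on with
  | empty => exact ⟨1, by simp⟩
  | insert j s hj ih =>
    obtain ⟨C₁, h₁⟩ := h j (Finset.mem_insert_self j s)
    obtain ⟨C₂, h₂⟩ := ih fun i hi => h i (Finset.mem_insert_of_mem hi)
    refine ⟨C₁ * C₂, fun t => ?_⟩
    rw [Finset.prod_insert hj, norm_mul]
    exact mul_le_mul (h₁ t) (h₂ t) (norm_nonneg _) ((norm_nonneg _).trans (h₁ t))

lemma exists_norm_mul_le {α : Type*} {f g : α → ℂ} (hf : ∃ C : ℝ, ∀ t, ‖f t‖ ≤ C)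
    (hg : ∃ C : ℝ, ∀ t, ‖g t‖ ≤ C) : ∃ C : ℝ, ∀ t, ‖f t * g t‖ ≤ C := by
  obtain ⟨C₁, h₁⟩ := hf
  obtain ⟨C₂, h₂⟩ := hg
  refine ⟨C₁ * C₂, fun t => ?_⟩
  rw [norm_mul]
  exact mul_le_mul (h₁ t) (h₂ t) (norm_nonneg _) ((norm_nonneg _).trans (h₁ t))

lemma integrable_exp_neg_mul_abs {c : ℝ} (hc : 0 < c) :
    Integrable fun t : ℝ => Real.exp (-c * |t|) := by
  rw [← integrableOn_univ, ← Set.Iic_union_Ioi (a := (0 : ℝ))]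
  refine IntegrableOn.union ?_ ?_
  · refine (integrableOn_exp_mul_Iic hc 0).congr_fun (fun t ht => ?_) measurableSet_Iic
    simp [abs_of_nonpos (Set.mem_Iic.1 ht)]
  · refine (integrableOn_exp_mul_Ioi (neg_lt_zero.2 hc) 0).congr_fun (fun t ht => ?_)
      measurableSet_Ioi
    simp [abs_of_pos (Set.mem_Ioi.1 ht)]

lemma measurable_qG {q : ℝ} (hq0 : 0 < q) (hq1 : q < 1) : Measurable (qG q) := by
  unfold qG
  exact measurable_const.div (continuous_qPochInf hq0 hq1).measurable

lemma measurable_foxHIntegrand {q : ℝ} (hq0 : 0 < q) (hq1 : q < 1) {M N : ℕ} (m n : ℕ)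
    (a : Fin M → ℂ × ℝ) (b : Fin N → ℂ × ℝ) (x : ℂ) :
    Measurable (foxHIntegrand q m n a b x) := by
  have hG : ∀ {f : ℂ → ℂ}, Measurable f → Measurable fun s => qG q ((q : ℂ) ^ f s) :=
    fun hf => (measurable_qG hq0 hq1).comp (hf.const_pow _)
  unfold foxHIntegrand
  refine Measurable.div (.mul (.mul (.mul ?_ ?_) measurable_const) (measurable_id.const_pow x))
    (.mul (.mul (.mul ?_ ?_) ?_) (Complex.measurable_sin.comp (measurable_id.const_mul _)))
  · exact Finset.measurable_fun_prod _ fun j _ => hG (by fun_prop)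
  · exact Finset.measurable_fun_prod _ fun j _ => hG (by fun_prop)
  · exact Finset.measurable_fun_prod _ fun j _ => hG (by fun_prop)
  · exact Finset.measurable_fun_prod _ fun j _ => hG (by fun_prop)
  · exact hG (by fun_prop)

/-- Separates the factors that are merely bounded on a contour from the last one, which supplies the
decay. -/
lemma foxHIntegrand_eq_mul (q : ℝ) {M N : ℕ} (m n : ℕ)
    (a : Fin M → ℂ × ℝ) (b : Fin N → ℂ × ℝ) (x s : ℂ) :
    foxHIntegrand q m n a b x s =
      (∏ j : Fin N with j.val < m, qG q ((q : ℂ) ^ ((b j).1 - (b j).2 * s))) *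
      (∏ j : Fin M with j.val < n, qG q ((q : ℂ) ^ (1 - (a j).1 + (a j).2 * s))) *
      (∏ j : Fin N with m ≤ j.val, qPochInf q ((q : ℂ) ^ (1 - (b j).1 + (b j).2 * s))) *
      (∏ j : Fin M with n ≤ j.val, qPochInf q ((q : ℂ) ^ ((a j).1 - (a j).2 * s))) *
      qPochInf q ((q : ℂ) ^ (1 - s)) * (π * (x ^ s / Complex.sin (π * s))) := by
  simp only [foxHIntegrand, div_eq_mul_inv, mul_inv, ← Finset.prod_inv_distrib]
  simp only [qG, one_div, inv_inv]
  ring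

/-! ### Estimates along an indented vertical line -/

section Contour

variable {γ : ℝ → ℂ}

lemma IsIndentedVerticalLine.exists_abs_re_add_le (h : IsIndentedVerticalLine γ) (w : ℂ) (d : ℝ) :
    ∃ R : ℝ, ∀ t, |(w + d * γ t).re| ≤ R := by
  obtain ⟨c, B, hB⟩ := h.near_line
  refine ⟨|w.re| + |d| * (|c| + B), fun t => ?_⟩
  have h1 := (Complex.abs_re_le_norm _).trans (hB t)
  simp only [Complex.sub_re, Complex.add_re, Complex.ofReal_re, Complex.mul_re, Complex.I_re,
    mul_zero, Complex.ofReal_im, Complex.I_im, zero_mul, sub_zero, add_zero] at h1 ⊢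
  have h2 : |(γ t).re| ≤ |c| + B := by
    have := abs_add_le c ((γ t).re - c)
    rw [add_sub_cancel] at this
    linarith
  refine (abs_add_le _ _).trans ?_
  rw [abs_mul]
  gcongr

lemma IsIndentedVerticalLine.exists_norm_qPochInf_le (h : IsIndentedVerticalLine γ) {q : ℝ}
    (hq0 : 0 < q) (hq1 : q < 1) (w : ℂ) (d : ℝ) :
    ∃ C : ℝ, ∀ t, ‖qPochInf q ((q : ℂ) ^ (w + d * γ t))‖ ≤ C := by
  obtain ⟨R, hR⟩ := h.exists_abs_re_add_le w d
  obtain ⟨C, -, hC⟩ := _root_.exists_norm_qPochInf_le hq0 hq1 (q ^ (-R))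
  exact ⟨C, fun t => hC _ (norm_ofReal_cpow_le hq0 hq1 (hR t))⟩

lemma IsIndentedVerticalLine.exists_norm_qG_le (h : IsIndentedVerticalLine γ) {q : ℝ}
    (hq0 : 0 < q) (hq1 : q < 1) (w : ℂ) {d : ℝ} (hd : d ≠ 0) {δ : ℝ} (hδ : 0 < δ)
    (haway : ∀ p : ℂ, (∃ r : ℕ, 1 - (q : ℂ) ^ (w + d * p) * (q : ℂ) ^ r = 0) →
      ∀ t, δ ≤ ‖γ t - p‖) :
    ∃ C : ℝ, ∀ t, ‖qG q ((q : ℂ) ^ (w + d * γ t))‖ ≤ C := by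
  have hdC : (d : ℂ) ≠ 0 := by exact_mod_cast hd
  obtain ⟨R, hR⟩ := h.exists_abs_re_add_le w d
  -- The substitution `s ↦ w + d s` scales distances to poles by `|d|`.
  obtain ⟨C, hC⟩ := exists_norm_qG_cpow_le hq0 hq1 (mul_pos (abs_pos.2 hd) hδ) R
  refine ⟨C, fun t => hC _ (hR t) fun p hp => ?_⟩
  have hp' : w + d * ((p - w) / d) = p := by field_simp; ring
  have h1 := haway ((p - w) / d) (by rwa [hp']) t
  have h2 : w + d * γ t - p = d * (γ t - (p - w) / d) := by field_simp; ring
  rw [h2, norm_mul, Complex.norm_real, Real.norm_eq_abs]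
  exact mul_le_mul_of_nonneg_left h1 (abs_nonneg d)

/-- On a contour, `x^s / sin (π s)` decays exponentially if `|arg x| < π`. -/
lemma IsIndentedVerticalLine.exists_norm_cpow_div_sin_le (h : IsIndentedVerticalLine γ)
    {δ : ℝ} (hδ : 0 < δ) (haway : ∀ l : ℤ, ∀ t, δ ≤ ‖γ t - l‖) {x : ℂ} (hx : x ≠ 0) :
    ∃ C : ℝ, ∀ t, ‖x ^ γ t / Complex.sin (π * γ t)‖ ≤ C * Real.exp (-(π - |x.arg|) * |t|) := by
  obtain ⟨R, hR⟩ := h.exists_abs_re_add_le 0 1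
  obtain ⟨c, B, hB⟩ := h.near_line
  obtain ⟨η, hη, hsin⟩ := exists_le_norm_sin hδ
  -- With `|Re γ| ≤ R` and `|Im γ - t| ≤ B`, the numerator is at most `exp (|log ‖x‖| R + |arg x|
  -- (|t| + B))` and the sine at least `η exp (π (|t| - B))`.
  refine ⟨Real.exp (|Real.log ‖x‖| * R + |x.arg| * B + π * B) / η, fun t => ?_⟩
  have hre : |(γ t).re| ≤ R := by simpa using hR t
  have him : |(γ t).im - t| ≤ B := by
    simpa using (Complex.abs_im_le_norm _).trans (hB t)
  have him1 : |(γ t).im| ≤ |t| + B := by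
    have := abs_add_le t ((γ t).im - t)
    rw [add_sub_cancel] at this
    linarith
  have him2 : |t| - B ≤ |(γ t).im| := by
    have := abs_sub_abs_le_abs_sub t (γ t).im
    rw [abs_sub_comm] at this
    linarith
  have hnum : ‖x ^ γ t‖ ≤ Real.exp (|Real.log ‖x‖| * R + |x.arg| * (|t| + B)) := by
    rw [Complex.cpow_def_of_ne_zero hx, Complex.norm_exp, Real.exp_le_exp, Complex.mul_re,
      Complex.log_re, Complex.log_im, sub_eq_add_neg]
    refine add_le_add ((le_abs_self _).trans ?_) ((neg_le_abs _).trans ?_)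
    · rw [abs_mul]
      gcongr
    · rw [abs_mul]
      gcongr
  have hden : η * Real.exp (π * (|t| - B)) ≤ ‖Complex.sin (π * γ t)‖ := by
    refine le_trans ?_ (hsin _ fun l => haway l t)
    gcongr
  rw [norm_div]
  refine (div_le_div₀ (Real.exp_pos _).le hnum (by positivity) hden).trans_eq ?_
  rw [div_mul_eq_div_div, div_mul_eq_mul_div, ← Real.exp_add, div_right_comm, ← Real.exp_sub]
  congr 2
  ring

end Contour

/-- The Mellin–Barnes integral converges absolutely for `|arg x| < π`. -/
lemma IsFoxHContour.foxHConverges {q : ℝ} (hq0 : 0 < q) (hq1 : q < 1) {γ : ℝ → ℂ} {M N m n : ℕ}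
    {a : Fin M → ℂ × ℝ} {b : Fin N → ℂ × ℝ} (hγ : IsFoxHContour q γ m n a b)
    (hα : ∀ j, 0 < (a j).2) (hβ : ∀ j, 0 < (b j).2) {x : ℂ} (hx : x ≠ 0) (hxarg : |x.arg| < π) :
    FoxHConverges q γ m n a b x := by
  have hline := hγ.line
  obtain ⟨δ, hδ, haway⟩ := hγ.away
  obtain ⟨L, hL⟩ := hline.lipschitz
  obtain ⟨C₂, hC₂⟩ := hline.exists_norm_cpow_div_sin_le hδ
    (fun l t => haway _ (Or.inr ⟨l, rfl⟩) t) hx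
  have hb₁ : ∃ C : ℝ, ∀ t, ‖∏ j : Fin N with j.val < m,
      qG q ((q : ℂ) ^ ((b j).1 - (b j).2 * γ t))‖ ≤ C := by
    refine exists_norm_prod_le _ fun j hj => ?_
    have hj' : j.val < m := (Finset.mem_filter.1 hj).2
    have key := hline.exists_norm_qG_le hq0 hq1 (b j).1 (neg_ne_zero.2 (hβ j).ne') hδ
      fun p ⟨r, hr⟩ t => haway p (Or.inl (Or.inl ⟨j, hj', r, by simpa [sub_eq_add_neg] using hr⟩)) t
    simpa [sub_eq_add_neg] using key
  have hb₂ : ∃ C : ℝ, ∀ t, ‖∏ j : Fin M with j.val < n,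
      qG q ((q : ℂ) ^ (1 - (a j).1 + (a j).2 * γ t))‖ ≤ C := by
    refine exists_norm_prod_le _ fun j hj => ?_
    have hj' : j.val < n := (Finset.mem_filter.1 hj).2
    exact hline.exists_norm_qG_le hq0 hq1 (1 - (a j).1) (hα j).ne' hδ
      fun p ⟨r, hr⟩ t => haway p (Or.inl (Or.inr ⟨j, hj', r, hr⟩)) t
  have hb₃ : ∃ C : ℝ, ∀ t, ‖∏ j : Fin N with m ≤ j.val,
      qPochInf q ((q : ℂ) ^ (1 - (b j).1 + (b j).2 * γ t))‖ ≤ C :=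
    exists_norm_prod_le _ fun j _ => hline.exists_norm_qPochInf_le hq0 hq1 _ _
  have hb₄ : ∃ C : ℝ, ∀ t, ‖∏ j : Fin M with n ≤ j.val,
      qPochInf q ((q : ℂ) ^ ((a j).1 - (a j).2 * γ t))‖ ≤ C := by
    refine exists_norm_prod_le _ fun j _ => ?_
    simpa [sub_eq_add_neg] using hline.exists_norm_qPochInf_le hq0 hq1 (a j).1 (-(a j).2)
  have hb₅ : ∃ C : ℝ, ∀ t, ‖qPochInf q ((q : ℂ) ^ (1 - γ t))‖ ≤ C := by
    simpa [sub_eq_add_neg] using hline.exists_norm_qPochInf_le hq0 hq1 1 (-1)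
  obtain ⟨C₁, hC₁⟩ := exists_norm_mul_le (exists_norm_mul_le (exists_norm_mul_le
    (exists_norm_mul_le hb₁ hb₂) hb₃) hb₄) hb₅
  have hC₁0 : 0 ≤ C₁ := (norm_nonneg _).trans (hC₁ 0)
  -- The factor `L` bounds `deriv γ` at every `t`, including points where `γ` is not differentiable
  -- and `deriv` is `0`.
  refine Integrable.mono' ((integrable_exp_neg_mul_abs (sub_pos.2 hxarg)).const_mul
    (C₁ * (π * C₂) * L)) ((((measurable_foxHIntegrand hq0 hq1 m n a b x).comp
      hL.continuous.measurable).mul (measurable_deriv γ)).aestronglyMeasurable)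
    (Eventually.of_forall fun t => ?_)
  rw [foxHIntegrand_eq_mul, norm_mul, norm_mul, norm_mul (π : ℂ), Complex.norm_real,
    Real.norm_of_nonneg Real.pi_pos.le]
  have hC₂0 := (norm_nonneg _).trans (hC₂ t)
  calc _ ≤ C₁ * (π * (C₂ * Real.exp (-(π - |x.arg|) * |t|))) * L :=
        mul_le_mul (mul_le_mul (hC₁ t) (mul_le_mul_of_nonneg_left (hC₂ t) Real.pi_pos.le)
          (by positivity) hC₁0) (norm_deriv_le_of_lipschitz hL) (norm_nonneg _) (by positivity)
    _ = _ := by ring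

/-! ### The contour for the extended parameters -/

lemma mem_foxUpperPoles_cons {q : ℝ} {M n : ℕ} {a₀ : ℂ} {α₀ : ℝ} {a : Fin M → ℂ × ℝ} {p : ℂ} :
    p ∈ foxUpperPoles q (n + 1) (Fin.cons (a₀, α₀) a : Fin (M + 1) → ℂ × ℝ) ↔
      (∃ r : ℕ, 1 - (q : ℂ) ^ (1 - a₀ + α₀ * p) * (q : ℂ) ^ r = 0) ∨ p ∈ foxUpperPoles q n a := by
  simp [foxUpperPoles, Fin.exists_fin_succ]

lemma mem_foxLowerPoles_cons {q : ℝ} {N m : ℕ} {b₀ : ℂ} {β₀ : ℝ} {b : Fin N → ℂ × ℝ} {p : ℂ} :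
    p ∈ foxLowerPoles q (m + 1) (Fin.cons (b₀, β₀) b : Fin (N + 1) → ℂ × ℝ) ↔
      (∃ r : ℕ, 1 - (q : ℂ) ^ (b₀ - β₀ * p) * (q : ℂ) ^ r = 0) ∨ p ∈ foxLowerPoles q m b := by
  simp [foxLowerPoles, Fin.exists_fin_succ]

/-- Prepending a parameter while raising `n` shifts both the indices and the threshold by one, so
the old factors keep their places. -/
lemma foxHIntegrand_cons_upper (q : ℝ) {M N : ℕ} (m n : ℕ) (a₀ : ℂ) (α₀ : ℝ)
    (a : Fin M → ℂ × ℝ) (b : Fin N → ℂ × ℝ) (x s : ℂ) :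
    foxHIntegrand q m (n + 1) (Fin.cons (a₀, α₀) a : Fin (M + 1) → ℂ × ℝ) b x s =
      qG q ((q : ℂ) ^ (1 - a₀ + α₀ * s)) * foxHIntegrand q m n a b x s := by
  simp [foxHIntegrand, Finset.prod_filter, Fin.prod_univ_succ]
  ring

lemma foxHIntegrand_cons_lower (q : ℝ) {M N : ℕ} (m n : ℕ) (b₀ : ℂ) (β₀ : ℝ)
    (a : Fin M → ℂ × ℝ) (b : Fin N → ℂ × ℝ) (x s : ℂ) :
    foxHIntegrand q (m + 1) n a (Fin.cons (b₀, β₀) b : Fin (N + 1) → ℂ × ℝ) x s =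
      qG q ((q : ℂ) ^ (b₀ - β₀ * s)) * foxHIntegrand q m n a b x s := by
  simp [foxHIntegrand, Finset.prod_filter, Fin.prod_univ_succ]
  ring

/-- Such a zero forces `|q^(w + r)| = 1`, hence `Re w = -r`; the sign is all that locating the new
poles requires. -/
lemma re_nonpos_of_one_sub_cpow_mul_pow_eq_zero {q : ℝ} (hq0 : 0 < q) (hq1 : q < 1) {w : ℂ}
    {r : ℕ} (h : 1 - (q : ℂ) ^ w * (q : ℂ) ^ r = 0) : w.re ≤ 0 := by
  have h1 : ‖(q : ℂ) ^ (w + r)‖ = 1 := by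
    rw [← ofReal_cpow_mul_pow hq0, ← sub_eq_zero.1 h, norm_one]
  rw [Complex.norm_cpow_eq_rpow_re_of_pos hq0] at h1
  by_contra! hw
  have : q ^ (w + r).re < 1 := Real.rpow_lt_one hq0.le hq1 (by
    rw [Complex.add_re, Complex.natCast_re]
    positivity)
  exact absurd h1 this.ne

/-- The open half-plane `Re < R` is convex and misses the curve, so straight segments serve as
paths. -/
lemma isLeftOf_of_re_lt {γ : ℝ → ℂ} {R : ℝ} (hR : ∀ t, R ≤ (γ t).re) {p : ℂ} (hp : p.re < R) :
    IsLeftOf γ p := by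
  refine ⟨R, fun z hz => JoinedIn.of_segment_subset ?_⟩
  refine ((convex_halfSpace_re_lt R).segment_subset hp hz).trans ?_
  rintro w hw ⟨t, rfl⟩
  exact absurd (hR t) (not_le.2 hw)

lemma isRightOf_of_lt_re {γ : ℝ → ℂ} {R : ℝ} (hR : ∀ t, (γ t).re ≤ R) {p : ℂ} (hp : R < p.re) :
    IsRightOf γ p := by
  refine ⟨R, fun z hz => JoinedIn.of_segment_subset ?_⟩
  refine ((convex_halfSpace_re_gt R).segment_subset hp hz).trans ?_
  rintro w hw ⟨t, rfl⟩
  exact absurd (hR t) (not_le.2 hw)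

/-- The contour lies in `Re s ≥ (c - Re λ) / k` and the new poles in `Re p ≤ (-1 - Re λ) / k`, which
leaves a gap of width `(c + 1) / k`. -/
lemma IsFoxHContour.cons_upper {q : ℝ} (hq0 : 0 < q) (hq1 : q < 1) {γ : ℝ → ℂ} {M N m n : ℕ}
    {a : Fin M → ℂ × ℝ} {b : Fin N → ℂ × ℝ} (hγ : IsFoxHContour q γ m n a b) {lam : ℂ} {k : ℝ}
    (hk : 0 < k) {c : ℝ} (hc : -1 < c) (hγlam : ∀ t, c ≤ (lam + (k : ℂ) * γ t).re) :
    IsFoxHContour q γ m (n + 1) (Fin.cons (-lam, k) a : Fin (M + 1) → ℂ × ℝ) b := by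
  have hre : ∀ t, (c - lam.re) / k ≤ (γ t).re := fun t => by
    rw [div_le_iff₀ hk]
    have := hγlam t
    simp at this
    linarith
  have hpole : ∀ p : ℂ, (∃ r : ℕ, 1 - (q : ℂ) ^ (1 - -lam + k * p) * (q : ℂ) ^ r = 0) →
      p.re + (c + 1) / k ≤ (c - lam.re) / k := fun p ⟨r, hr⟩ => by
    have := re_nonpos_of_one_sub_cpow_mul_pow_eq_zero hq0 hq1 hr
    simp at this
    rw [← sub_nonneg, show (c - lam.re) / k - (p.re + (c + 1) / k) = (-(1 + lam.re + k * p.re)) / k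
      by field_simp; ring]
    exact div_nonneg (by linarith) hk.le
  have hpos : 0 < (c + 1) / k := div_pos (by linarith) hk
  obtain ⟨δ, hδ, haway⟩ := hγ.away
  refine ⟨hγ.line, hγ.right, fun p hp => ?_, min δ ((c + 1) / k), lt_min hδ hpos, ?_⟩
  · rcases mem_foxUpperPoles_cons.1 hp with h | h
    · exact isLeftOf_of_re_lt hre (by linarith [hpole p h])
    · exact hγ.left p h
  · rintro p ((hp | hp) | hp) t
    · exact (min_le_left _ _).trans (haway p (Or.inl (Or.inl hp)) t)
    · rcases mem_foxUpperPoles_cons.1 hp with h | h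
      · refine (min_le_right _ _).trans (le_trans ?_ (Complex.re_le_norm _))
        rw [Complex.sub_re]
        linarith [hpole p h, hre t]
      · exact (min_le_left _ _).trans (haway p (Or.inl (Or.inr h)) t)
    · exact (min_le_left _ _).trans (haway p (Or.inr hp) t)

/-- Mirror image of `IsFoxHContour.cons_upper`: dividing by `k < 0` reverses the inequalities, and
the gap has width `-(c + 1) / k`. -/
lemma IsFoxHContour.cons_lower {q : ℝ} (hq0 : 0 < q) (hq1 : q < 1) {γ : ℝ → ℂ} {M N m n : ℕ}
    {a : Fin M → ℂ × ℝ} {b : Fin N → ℂ × ℝ} (hγ : IsFoxHContour q γ m n a b) {lam : ℂ} {k : ℝ}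
    (hk : k < 0) {c : ℝ} (hc : -1 < c) (hγlam : ∀ t, c ≤ (lam + (k : ℂ) * γ t).re) :
    IsFoxHContour q γ (m + 1) n a (Fin.cons (1 + lam, -k) b : Fin (N + 1) → ℂ × ℝ) := by
  have hre : ∀ t, (γ t).re ≤ (c - lam.re) / k := fun t => by
    rw [le_div_iff_of_neg hk]
    have := hγlam t
    simp at this
    linarith
  have hpole : ∀ p : ℂ, (∃ r : ℕ, 1 - (q : ℂ) ^ (1 + lam - (-k : ℝ) * p) * (q : ℂ) ^ r = 0) →
      (c - lam.re) / k ≤ p.re + (c + 1) / k := fun p ⟨r, hr⟩ => by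
    have := re_nonpos_of_one_sub_cpow_mul_pow_eq_zero hq0 hq1 hr
    simp at this
    have hk0 := hk.ne
    rw [← sub_nonneg, show p.re + (c + 1) / k - (c - lam.re) / k = (1 + lam.re + k * p.re) / k
      by field_simp; ring]
    exact div_nonneg_of_nonpos (by linarith) hk.le
  have hneg : (c + 1) / k < 0 := div_neg_of_pos_of_neg (by linarith) hk
  obtain ⟨δ, hδ, haway⟩ := hγ.away
  refine ⟨hγ.line, fun p hp => ?_, hγ.left, min δ (-((c + 1) / k)), lt_min hδ (by linarith), ?_⟩
  · rcases mem_foxLowerPoles_cons.1 hp with h | h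
    · exact isRightOf_of_lt_re hre (by linarith [hpole p h])
    · exact hγ.right p h
  · rintro p ((hp | hp) | hp) t
    · rcases mem_foxLowerPoles_cons.1 hp with h | h
      · rw [norm_sub_rev]
        refine (min_le_right _ _).trans (le_trans ?_ (Complex.re_le_norm _))
        rw [Complex.sub_re]
        linarith [hpole p h, hre t]
      · exact (min_le_left _ _).trans (haway p (Or.inl (Or.inl h)) t)
    · exact (min_le_left _ _).trans (haway p (Or.inl (Or.inr hp)) t)
    · exact (min_le_left _ _).trans (haway p (Or.inr hp) t)

/-! ### Principal powers -/

/-- The condition on the arguments excludes a branch jump in `log (u / v)`, and a positive factor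
changes only the real part of the logarithm. -/
lemma log_div_mul_ofReal_pow {q : ℝ} (hq0 : 0 < q) {u v : ℂ} (hu : u ≠ 0) (hv : v ≠ 0)
    (huv : u.arg - v.arg ∈ Set.Ioc (-π) π) (r : ℕ) :
    Complex.log (u / v * (q : ℂ) ^ r) = Complex.log u - Complex.log v + r * Real.log q := by
  have harg : (u / v).arg = u.arg - v.arg := by
    rw [← Complex.arg_coe_angle_toReal_eq_arg, Complex.arg_div_coe_angle hu hv,
      ← Real.Angle.coe_sub, Real.Angle.toReal_coe_eq_self_iff_mem_Ioc.2 huv]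
  have hlog : Complex.log (u / v) = Complex.log u - Complex.log v := by
    apply Complex.ext
    · rw [Complex.sub_re, Complex.log_re, Complex.log_re, Complex.log_re, norm_div,
        Real.log_div (norm_ne_zero_iff.2 hu) (norm_ne_zero_iff.2 hv)]
    · rw [Complex.sub_im, Complex.log_im, Complex.log_im, Complex.log_im, harg]
  rw [← Complex.ofReal_pow, Complex.log_mul_ofReal _ (pow_pos hq0 r) _ (div_ne_zero hu hv), hlog,
    Real.log_pow]
  push_cast
  ring

lemma div_mul_ofReal_pow_cpow {q : ℝ} (hq0 : 0 < q) {u v : ℂ} (hu : u ≠ 0) (hv : v ≠ 0)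
    (huv : u.arg - v.arg ∈ Set.Ioc (-π) π) (r : ℕ) (w : ℂ) :
    (u / v * (q : ℂ) ^ r) ^ w = u ^ w / v ^ w * ((q : ℂ) ^ w) ^ r := by
  have hq : (q : ℂ) ≠ 0 := by exact_mod_cast hq0.ne'
  rw [Complex.cpow_def_of_ne_zero (mul_ne_zero (div_ne_zero hu hv) (pow_ne_zero r hq)),
    log_div_mul_ofReal_pow hq0 hu hv huv, Complex.cpow_def_of_ne_zero hu,
    Complex.cpow_def_of_ne_zero hv, ofReal_cpow_eq_exp hq0, ← Complex.exp_nat_mul,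
    ← Complex.exp_sub, ← Complex.exp_add]
  ring_nf

lemma mul_ofReal_cpow_pow_cpow {q : ℝ} (hq0 : 0 < q) {x : ℂ} (hx : x ≠ 0) (k : ℝ) (r : ℕ)
    (s : ℂ) : (x * ((q : ℂ) ^ (k : ℂ)) ^ r) ^ s = x ^ s * ((q : ℂ) ^ (k * s)) ^ r := by
  have hpos : 0 < (q ^ k) ^ r := pow_pos (Real.rpow_pos_of_pos hq0 k) r
  have hcast : ((q : ℂ) ^ (k : ℂ)) ^ r = (((q ^ k) ^ r : ℝ) : ℂ) := by
    rw [Complex.ofReal_pow, Complex.ofReal_cpow hq0.le]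
  rw [hcast, Complex.cpow_def_of_ne_zero (mul_ne_zero hx (by exact_mod_cast hpos.ne')),
    Complex.log_mul_ofReal _ hpos _ hx, Real.log_pow, Real.log_rpow hq0,
    Complex.cpow_def_of_ne_zero hx, ofReal_cpow_eq_exp hq0, ← Complex.exp_nat_mul,
    ← Complex.exp_add]
  push_cast
  ring_nf

lemma arg_mul_ofReal_cpow_pow {q : ℝ} (hq0 : 0 < q) (x : ℂ) (k : ℝ) (r : ℕ) :
    (x * ((q : ℂ) ^ (k : ℂ)) ^ r).arg = x.arg := by
  rw [← Complex.ofReal_cpow hq0.le, ← Complex.ofReal_pow,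
    Complex.arg_mul_real (pow_pos (Real.rpow_pos_of_pos hq0 k) r)]

/-! ### Exchange of summation and integration -/

/-- The terms are dominated by `C ρ^r ‖Φ‖`, whose integrals are summable, so the sum may be taken
under the integral, where it is Euler's expansion. -/
lemma hasSum_integral_qPochInf_mul_pow {q : ℝ} (hq0 : 0 < q) (hq1 : q < 1) {W Φ : ℝ → ℂ}
    (hW : Measurable W) {ρ : ℝ} (hρ : ρ < 1) (hWρ : ∀ t, ‖W t‖ ≤ ρ) (hΦ : Integrable Φ) :
    Summable (fun r : ℕ => ‖∫ t, qPochInf q ((q : ℂ) ^ (r + 1)) * W t ^ r * Φ t‖) ∧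
    HasSum (fun r : ℕ => ∫ t, qPochInf q ((q : ℂ) ^ (r + 1)) * W t ^ r * Φ t)
      (qPochInf q q * ∫ t, qG q (W t) * Φ t) := by
  obtain ⟨C, hC0, hC⟩ := exists_norm_qPochInf_le hq0 hq1 1
  have hρ0 : 0 ≤ ρ := (norm_nonneg _).trans (hWρ 0)
  have hbound : ∀ (r : ℕ) t, ‖qPochInf q ((q : ℂ) ^ (r + 1)) * W t ^ r‖ ≤ C * ρ ^ r :=
    fun r t => by
      rw [norm_mul, norm_pow]
      exact mul_le_mul (hC _ (norm_ofReal_pow_succ_le_one hq0 hq1 r))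
        (pow_le_pow_left₀ (norm_nonneg _) (hWρ t) r) (by positivity) hC0
  have hint : ∀ r : ℕ, Integrable fun t => qPochInf q ((q : ℂ) ^ (r + 1)) * W t ^ r * Φ t :=
    fun r => hΦ.bdd_mul (by fun_prop) (.of_forall (hbound r))
  have hsum : Summable fun r : ℕ => ∫ t, ‖qPochInf q ((q : ℂ) ^ (r + 1)) * W t ^ r * Φ t‖ := by
    refine Summable.of_nonneg_of_le (fun r => integral_nonneg fun t => norm_nonneg _) (fun r => ?_)
      (((summable_geometric_of_lt_one hρ0 hρ).mul_left C).mul_right (∫ t, ‖Φ t‖))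
    rw [← integral_const_mul]
    refine integral_mono (hint r).norm (hΦ.norm.const_mul _) fun t => ?_
    simp only [norm_mul (_ * _) (Φ t)]
    exact mul_le_mul_of_nonneg_right (hbound r t) (norm_nonneg _)
  refine ⟨hsum.of_nonneg_of_le (fun _ => norm_nonneg _)
    fun r => norm_integral_le_integral_norm _, ?_⟩
  have key := hasSum_integral_of_summable_integral_norm hint hsum
  have htsum : ∀ t, ∑' r : ℕ, qPochInf q ((q : ℂ) ^ (r + 1)) * W t ^ r * Φ t =
      qPochInf q q * (qG q (W t) * Φ t) := fun t => by
    rw [tsum_mul_right, (hasSum_qPochInf_mul_pow hq0 hq1 ((hWρ t).trans_lt hρ)).tsum_eq, mul_assoc]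
  simpa only [htsum, integral_const_mul] using key

/-- The `q`-Natural transform of `x^λ H[λ x^k]` as a contour integral. -/
lemma qNatural_cpow_mul_qFoxH {q : ℝ} (hq0 : 0 < q) (hq1 : q < 1) {M N m n : ℕ}
    {a : Fin M → ℂ × ℝ} {b : Fin N → ℂ × ℝ} {lam : ℂ} (hlam : lam ≠ 0) {k : ℝ}
    {u v : ℂ} (hu : u ≠ 0) (hv : v ≠ 0) (huv : u.arg - v.arg ∈ Set.Ioc (-π) π)
    {γ : ℝ → ℂ} (hγ : Measurable γ) {c : ℝ} (hc : -1 < c)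
    (hγlam : ∀ t, c ≤ (lam + (k : ℂ) * γ t).re)
    (hconv : FoxHConverges q γ m n a b (lam * (u ^ (k : ℂ) / v ^ (k : ℂ)))) :
    QNaturalExists q (fun x => x ^ lam * qFoxH q γ m n a b (lam * x ^ (k : ℂ))) u v ∧
    qNatural q (fun x => x ^ lam * qFoxH q γ m n a b (lam * x ^ (k : ℂ))) u v =
      u ^ lam / (v ^ (lam + 1) * qG q (q : ℂ)) * (1 / (2 * (π : ℂ) * Complex.I) *
        ∫ t : ℝ, qG q ((q : ℂ) ^ (1 + lam + k * γ t)) *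
          (foxHIntegrand q m n a b (lam * (u ^ (k : ℂ) / v ^ (k : ℂ))) (γ t) * deriv γ t)) := by
  have hq : (q : ℂ) ≠ 0 := by exact_mod_cast hq0.ne'
  have hq1' : (1 : ℂ) - q ≠ 0 := sub_ne_zero.2 (by exact_mod_cast hq1.ne')
  set X : ℂ := lam * (u ^ (k : ℂ) / v ^ (k : ℂ)) with hX
  have hX0 : X ≠ 0 := mul_ne_zero hlam (div_ne_zero (by simp [Complex.cpow_eq_zero_iff, hu])
    (by simp [Complex.cpow_eq_zero_iff, hv]))
  set W : ℝ → ℂ := fun t => (q : ℂ) ^ (1 + lam + k * γ t) with hW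
  set Φ : ℝ → ℂ := fun t => foxHIntegrand q m n a b X (γ t) * deriv γ t with hΦ
  have hWm : Measurable W := by
    refine Measurable.const_pow ?_ _
    fun_prop
  have hWρ : ∀ t, ‖W t‖ ≤ q ^ (1 + c) := fun t => by
    rw [hW, Complex.norm_cpow_eq_rpow_re_of_pos hq0, add_assoc, Complex.add_re, Complex.one_re]
    exact Real.rpow_le_rpow_of_exponent_ge hq0 hq1.le (by linarith [hγlam t])
  obtain ⟨hs, hsum⟩ := hasSum_integral_qPochInf_mul_pow hq0 hq1 hWm
    (Real.rpow_lt_one hq0.le hq1 (by linarith)) hWρ hconv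
  set K : ℂ := u ^ lam / v ^ lam * (1 / (2 * (π : ℂ) * Complex.I)) with hK
  have hterm : ∀ r : ℕ, qNaturalIntegrand q
      (fun x => x ^ lam * qFoxH q γ m n a b (lam * x ^ (k : ℂ))) u v (u / v * (q : ℂ) ^ r) *
        (q : ℂ) ^ r = K * ∫ t, qPochInf q ((q : ℂ) ^ (r + 1)) * W t ^ r * Φ t := by
    intro r
    have hE : (q : ℂ) * (v / u) * (u / v * (q : ℂ) ^ r) = (q : ℂ) ^ (r + 1) := by
      field_simp
      ring
    -- All dependence on `r` other than `(q^(r+1); q)_∞` gathers into `W^r`: `q^(λ r)` from `t^λ`,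
    -- `q^r` from the Jackson weight, `q^(k s r)` from the argument of `H`.
    have hI : ∀ t, qPochInf q ((q : ℂ) ^ (r + 1)) * W t ^ r * Φ t =
        (((q : ℂ) ^ lam) ^ r * (q : ℂ) ^ r * qPochInf q ((q : ℂ) ^ (r + 1))) *
        (foxHIntegrand q m n a b (X * ((q : ℂ) ^ (k : ℂ)) ^ r) (γ t) * deriv γ t) := by
      intro t
      have hWr : W t ^ r = ((q : ℂ) ^ lam) ^ r * (q : ℂ) ^ r * ((q : ℂ) ^ (k * γ t)) ^ r := by
        simp only [hW]
        rw [Complex.cpow_add _ _ hq, Complex.cpow_add _ _ hq, Complex.cpow_one]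
        ring
      have hF : foxHIntegrand q m n a b (X * ((q : ℂ) ^ (k : ℂ)) ^ r) (γ t) =
          foxHIntegrand q m n a b X (γ t) * ((q : ℂ) ^ (k * γ t)) ^ r := by
        simp only [foxHIntegrand]
        rw [mul_ofReal_cpow_pow_cpow hq0 hX0]
        ring
      rw [hWr, hF]
      simp only [hΦ]
      ring
    simp only [hI, integral_const_mul]
    simp only [qNaturalIntegrand, qExpE, qFoxH, hE]
    rw [div_mul_ofReal_pow_cpow hq0 hu hv huv, div_mul_ofReal_pow_cpow hq0 hu hv huv, ← mul_assoc lam]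
    simp only [← hX, hK]
    ring
  refine ⟨?_, ?_⟩
  · unfold QNaturalExists JacksonIntegrable
    simp only [hterm, norm_mul K]
    exact hs.mul_left _
  · unfold qNatural jacksonIntegral
    simp only [hterm]
    rw [(hsum.mul_left K).tsum_eq, Complex.cpow_add _ _ hv, Complex.cpow_one]
    change _ = _ * (_ * ∫ t, qG q (W t) * Φ t)
    -- With the integral as an atom, only constants remain: `(1 - q) (u/v) / ((1 - q) u) = 1 / v`
    -- and `(q; q)_∞ = 1 / G(q)`.
    generalize (∫ t, qG q (W t) * Φ t) = J
    simp only [hK, qG]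
    field_simp

theorem theorem15 (q : ℝ) (hq0 : 0 < q) (hq1 : q < 1)
    {M N : ℕ} (m n : ℕ) (hm : m ≤ N) (hn : n ≤ M)
    (a : Fin M → ℂ × ℝ) (b : Fin N → ℂ × ℝ)
    (hα : ∀ j, 0 < (a j).2) (hβ : ∀ j, 0 < (b j).2)
    (lam : ℂ) (hlam : lam ≠ 0) (k : ℝ)
    (u v : ℂ) (hu : u ≠ 0) (hv : v ≠ 0)
    (huv : u.arg - v.arg ∈ Set.Ioc (-π) π)
    (harg : |(lam * (u ^ (k : ℂ) / v ^ (k : ℂ))).arg| < π)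
    (γ : ℝ → ℂ) (hγ : IsFoxHContour q γ m n a b)
    (hγlam : ∃ c : ℝ, -1 < c ∧ ∀ t : ℝ, c ≤ (lam + (k : ℂ) * γ t).re) :
    (0 < k →
      IsFoxHContour q γ m (n + 1) (Fin.cons (-lam, k) a : Fin (M + 1) → ℂ × ℝ) b ∧
      (∀ r : ℕ, FoxHConverges q γ m n a b (lam * (u / v * (q : ℂ) ^ r) ^ (k : ℂ))) ∧
      FoxHConverges q γ m (n + 1) (Fin.cons (-lam, k) a : Fin (M + 1) → ℂ × ℝ) b
        (lam * (u ^ (k : ℂ) / v ^ (k : ℂ))) ∧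
      QNaturalExists q (fun x => x ^ lam * qFoxH q γ m n a b (lam * x ^ (k : ℂ))) u v ∧
      qNatural q (fun x => x ^ lam * qFoxH q γ m n a b (lam * x ^ (k : ℂ))) u v =
        u ^ lam / (v ^ (lam + 1) * qG q (q : ℂ)) *
          qFoxH q γ m (n + 1) (Fin.cons (-lam, k) a : Fin (M + 1) → ℂ × ℝ) b
            (lam * (u ^ (k : ℂ) / v ^ (k : ℂ)))) ∧
    (k < 0 →
      IsFoxHContour q γ (m + 1) n a (Fin.cons (1 + lam, -k) b : Fin (N + 1) → ℂ × ℝ) ∧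
      (∀ r : ℕ, FoxHConverges q γ m n a b (lam * (u / v * (q : ℂ) ^ r) ^ (k : ℂ))) ∧
      FoxHConverges q γ (m + 1) n a (Fin.cons (1 + lam, -k) b : Fin (N + 1) → ℂ × ℝ)
        (lam * (u ^ (k : ℂ) / v ^ (k : ℂ))) ∧
      QNaturalExists q (fun x => x ^ lam * qFoxH q γ m n a b (lam * x ^ (k : ℂ))) u v ∧
      qNatural q (fun x => x ^ lam * qFoxH q γ m n a b (lam * x ^ (k : ℂ))) u v =
        u ^ lam / (v ^ (lam + 1) * qG q (q : ℂ)) *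
          qFoxH q γ (m + 1) n a (Fin.cons (1 + lam, -k) b : Fin (N + 1) → ℂ × ℝ)
            (lam * (u ^ (k : ℂ) / v ^ (k : ℂ)))) := by
  obtain ⟨c, hc, hcγ⟩ := hγlam
  have hX0 : lam * (u ^ (k : ℂ) / v ^ (k : ℂ)) ≠ 0 :=
    mul_ne_zero hlam (div_ne_zero (by simp [Complex.cpow_eq_zero_iff, hu])
      (by simp [Complex.cpow_eq_zero_iff, hv]))
  have hγm : Measurable γ := hγ.line.lipschitz.choose_spec.continuous.measurable
  have hconv : ∀ r : ℕ, FoxHConverges q γ m n a b (lam * (u / v * (q : ℂ) ^ r) ^ (k : ℂ)) := by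
    intro r
    -- At each node the argument of `H` is `X` times a positive real, so the bound on `arg X`
    -- carries over.
    rw [div_mul_ofReal_pow_cpow hq0 hu hv huv, ← mul_assoc]
    refine hγ.foxHConverges hq0 hq1 hα hβ (mul_ne_zero hX0 (pow_ne_zero r ?_)) ?_
    · simp [Complex.cpow_eq_zero_iff, hq0.ne']
    · rwa [arg_mul_ofReal_cpow_pow hq0]
  obtain ⟨hex, heq⟩ := qNatural_cpow_mul_qFoxH hq0 hq1 hlam hu hv huv hγm hc hcγ
    (hγ.foxHConverges hq0 hq1 hα hβ hX0 harg)
  refine ⟨fun hk => ?_, fun hk => ?_⟩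
  · have hγ' := hγ.cons_upper hq0 hq1 hk hc hcγ
    refine ⟨hγ', hconv, hγ'.foxHConverges hq0 hq1 (Fin.cases hk hα) hβ hX0 harg, hex, ?_⟩
    rw [heq]
    -- The exponent `1 - (-λ) + k s` of the new factor is that of `W`; for `k < 0` so is `(1 + λ) -
    -- (-k) s`.
    simp only [qFoxH, foxHIntegrand_cons_upper, mul_assoc, sub_neg_eq_add]
  · have hγ' := hγ.cons_lower hq0 hq1 hk hc hcγ
    refine ⟨hγ', hconv, hγ'.foxHConverges hq0 hq1 hα (Fin.cases (neg_pos.2 hk) hβ) hX0 harg,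
      hex, ?_⟩
    rw [heq]
    simp only [qFoxH, foxHIntegrand_cons_lower, mul_assoc, Complex.ofReal_neg, neg_mul,
      sub_neg_eq_add]
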